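/- **Setting.** Let $\Omega$ be a locally compact separable metric space with Borel $\sigma$-algebra $\mathcal B(\Omega)$, $\mathbb P$ a Borel probability measure on $\Omega$, and $\theta:\Omega\to\Omega$ an ergodic $\mathbb P$-preserving measurable map. Let $(X,d)$ be a nonempty compact metric space, and let $T=(T_\omega)_{\omega\in\Omega}$ be a continuous random dynamical system over $(\Omega,\mathcal B(\Omega),\mathbb P,\theta)$: maps $T_\omega:X\to X$ such that $(\omega,x)\mapsto T_\omega x$ is measurable and every $T_\omega$ is continuous. Put $T_\omega^0=\mathrm{id}$, $T_\omega^n=T_{\theta^{n-1}\omega}\circ\cdots\circ T_\omega$ for $n\ge 1$, and $\Theta(\omega,x)=(\theta\omega,T_\omega x)$. Let $L^1(\Omega,C(X))$ be the set of functions $f:\Omega\times X\to\mathbb R$ that are measurable in $(\omega,x)$, continuous in $x$ for every $\omega$, and satisfy $\int\sup_{x\in X}|f(\omega,x)|\,d\mathbb P(\omega)<\infty$. For $f\in L^1(\Omega,C(X))$ write $S_nf(\omega,x)=\sum_{j=0}^{n-1}f(\theta^j\omega,T_\omega^jx)$ and $d_n^\omega(x,y)=\max_{0\le j\le n-1}d(T_\omega^jx,T_\omega^jy)$.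 A set $F\subset X$ is $(\omega,n,\epsilon)$-separated if $d_n^\omega(x,y)>\epsilon$ for all distinct $x,y\in F$. Define $$P_n(T,f,d,\omega,\epsilon)=\sup\Big\{\sum_{x\in F}(1/\epsilon)^{S_nf(\omega,x)}:F\text{ is }(\omega,n,\epsilon)\text{-separated}\Big\},$$ $$\mathbb E\overline{\mathrm{mdim}}_M(T,f,d)=\limsup_{\epsilon\to0^+}\frac{1}{\log\frac1\epsilon}\limsup_{n\to\infty}\frac1n\int\log P_n(T,f,d,\omega,\epsilon)\,d\mathbb P(\omega),$$ and $\mathbb E\overline{\mathrm{mdim}}_M(T,X,d)=\mathbb E\overline{\mathrm{mdim}}_M(T,0,d)$. Let $\mathcal P_{\mathbb P}(\Omega\times X)$ be the set of probability measures on $\mathcal B(\Omega)\otimes\mathcal B(X)$ with marginal $\mathbb P$ on $\Omega$, and let $\mathcal M_{\mathbb P}(\Omega\times X)$ be the set of those that are $\Theta$-invariant. For $\mu\in\mathcal P_{\mathbb P}(\Omega\times X)$ define $$F(\mu,d)=\inf\Big\{\mathbb E\overline{\mathrm{mdim}}_M(T,f,d)-\int f\,d\mu:f\in L^1(\Omega,C(X))\Big\}\in[-\infty,\infty],$$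 and let $\mathcal A=\{f\in L^1(\Omega,C(X)):\mathbb E\overline{\mathrm{mdim}}_M(T,-f,d)=0\}$. **Theorem.** Suppose that $\mathbb E\overline{\mathrm{mdim}}_M(T,X,d)<\infty$. Then $F(\mu,d)=\inf_{f\in\mathcal A}\int f\,d\mu$ for every $\mu\in\mathcal P_{\mathbb P}(\Omega\times X)$ (in particular for every $\mu\in\mathcal M_{\mathbb P}(\Omega\times X)$), and $$\mathbb E\overline{\mathrm{mdim}}_M(T,X,d)=\sup_{\mu\in\mathcal M_{\mathbb P}(\Omega\times X)}F(\mu,d),$$ and the supremum is attained by some $\mu\in\mathcal M_{\mathbb P}(\Omega\times X)$. -/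

import Mathlib

open MeasureTheory Filter Topology

noncomputable section

namespace RandomMdim

variable {Ω X : Type*}

/-- The fibre iterates `T_ω^n = T_{θ^{n-1} ω} ∘ ⋯ ∘ T_ω`, with `T_ω^0 = id`. -/
def iter (θ : Ω → Ω) (T : Ω → X → X) : ℕ → Ω → X → X
  | 0, _, x => x
  | n + 1, ω, x => T (θ^[n] ω) (iter θ T n ω x)

/-- The skew product `Θ(ω, x) = (θ ω, T_ω x)`. -/
def skew (θ : Ω → Ω) (T : Ω → X → X) (p : Ω × X) : Ω × X :=
  (θ p.1, T p.1 p.2)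

/-- The maps `T_ω : X → X` generate a continuous random dynamical system: `(ω, x) ↦ T_ω x` is
measurable for the product σ-algebra and every `T_ω` is continuous. -/
structure IsContinuousRDS [MeasurableSpace Ω] [TopologicalSpace X] [MeasurableSpace X]
    (T : Ω → X → X) : Prop where
  measurable : Measurable fun p : Ω × X => T p.1 p.2
  continuous : ∀ ω, Continuous (T ω)

/-- The random continuous functions `L¹(Ω, C(X))`: functions `f(ω, x)`, jointly measurable,
continuous in `x` for every `ω`, with `∫ sup_x |f(ω, x)| dP(ω) < ∞`. -/
def L1C [MeasurableSpace Ω] [TopologicalSpace X] [MeasurableSpace X] (P : Measure Ω) :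
    Set (Ω × X → ℝ) :=
  {f | Measurable f ∧ (∀ ω, Continuous fun x => f (ω, x)) ∧
    ∫⁻ ω, ⨆ x, ‖f (ω, x)‖ₑ ∂P < ⊤}

/-- The metric `d_n^ω(x, y) = max_{0 ≤ j ≤ n-1} d(T_ω^j x, T_ω^j y)`, for `n ≥ 1`. -/
def bowenDist [PseudoMetricSpace X] (θ : Ω → Ω) (T : Ω → X → X) (n : ℕ) (ω : Ω) (x y : X) : ℝ :=
  ⨆ j : Fin n, dist (iter θ T j ω x) (iter θ T j ω y)

/-- `F` is `(ω, n, ε)`-separated. On a compact space all separated sets are finite, so only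
finite sets are considered. -/
def IsSep [PseudoMetricSpace X] (θ : Ω → Ω) (T : Ω → X → X) (n : ℕ) (ω : Ω) (ε : ℝ)
    (F : Finset X) : Prop :=
  ∀ x ∈ F, ∀ y ∈ F, x ≠ y → ε < bowenDist θ T n ω x y

/-- The Birkhoff sum `S_n f(ω, x) = ∑_{j < n} f(θ^j ω, T_ω^j x)`. -/
def birkhoff (θ : Ω → Ω) (T : Ω → X → X) (f : Ω × X → ℝ) (n : ℕ) (ω : Ω) (x : X) : ℝ :=
  ∑ j ∈ Finset.range n, f (θ^[j] ω, iter θ T j ω x)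

/-- `P_n(T, f, d, ω, ε) = sup_F ∑_{x ∈ F} (1/ε)^{S_n f(ω, x)}` over `(ω, n, ε)`-separated sets.
For compact `X` and continuous `T_ω`, `f(ω, ·)`, the set on the right is bounded. -/
def sepSum [PseudoMetricSpace X] (θ : Ω → Ω) (T : Ω → X → X) (f : Ω × X → ℝ) (n : ℕ) (ω : Ω)
    (ε : ℝ) : ℝ :=
  sSup {s : ℝ | ∃ F : Finset X, IsSep θ T n ω ε F ∧
    s = ∑ x ∈ F, (1 / ε) ^ birkhoff θ T f n ω x}

/-- `P(T, f, d, ε) = limsup_n (1/n) ∫ log P_n(T, f, d, ω, ε) dP(ω)`. For `f ∈ L¹(Ω, C(X))`,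
`0 < ε < 1` and compact nonempty `X`, the integrand is integrable:
with `N` the size of a finite cover of `X` by sets of diameter at most `ε`, its absolute value is
at most `n log N + log(1/ε) ∑_{j < n} sup_x |f(θ^j ω, x)|`. -/
def pressure [MeasurableSpace Ω] [PseudoMetricSpace X] (P : Measure Ω) (θ : Ω → Ω)
    (T : Ω → X → X) (f : Ω × X → ℝ) (ε : ℝ) : EReal :=
  limsup (fun n : ℕ =>
    (((1 / (n : ℝ)) * ∫ ω, Real.log (sepSum θ T f n ω ε) ∂P : ℝ) : EReal)) atTop

/-- The upper random metric mean dimension with potential `f`,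
`limsup_{ε → 0+} P(T, f, d, ε) / log(1/ε)`. -/
def upperMdim [MeasurableSpace Ω] [PseudoMetricSpace X] (P : Measure Ω) (θ : Ω → Ω)
    (T : Ω → X → X) (f : Ω × X → ℝ) : EReal :=
  limsup (fun ε : ℝ => pressure P θ T f ε / ((Real.log (1 / ε) : ℝ) : EReal)) (𝓝[>] 0)

/-- The probability measures on `Ω × X` with marginal `P` on `Ω`. -/
def marginalMeasures [MeasurableSpace Ω] [MeasurableSpace X] (P : Measure Ω) :
    Set (Measure (Ω × X)) :=
  {μ | IsProbabilityMeasure μ ∧ μ.map Prod.fst = P}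

/-- The `Θ`-invariant probability measures on `Ω × X` with marginal `P` on `Ω`. -/
def invariantMeasures [MeasurableSpace Ω] [MeasurableSpace X] (P : Measure Ω) (θ : Ω → Ω)
    (T : Ω → X → X) : Set (Measure (Ω × X)) :=
  {μ | μ ∈ marginalMeasures P ∧ MeasurePreserving (skew θ T) μ μ}

/-- The upper measure-theoretical metric mean dimension of `μ`: the infimum over
`f ∈ L¹(Ω, C(X))` of the mean dimension with potential `f` minus `∫ f dμ`. -/
def measureMdim [MeasurableSpace Ω] [PseudoMetricSpace X] [MeasurableSpace X] (P : Measure Ω)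
    (θ : Ω → Ω) (T : Ω → X → X) (μ : Measure (Ω × X)) : EReal :=
  ⨅ f ∈ (L1C P : Set (Ω × X → ℝ)), (upperMdim P θ T f - ((∫ p, f p ∂μ : ℝ) : EReal))

/-- The set `𝒜` of all `f ∈ L¹(Ω, C(X))` for which the mean dimension with potential `-f` is
zero. -/
def zeroSet [MeasurableSpace Ω] [PseudoMetricSpace X] [MeasurableSpace X] (P : Measure Ω)
    (θ : Ω → Ω) (T : Ω → X → X) : Set (Ω × X → ℝ) :=
  {f | f ∈ (L1C P : Set (Ω × X → ℝ)) ∧ upperMdim P θ T (fun p => -f p) = 0}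

end RandomMdim

end

/-! The argument is convex duality. Once the mean dimension at the potential 0 is finite, `f ↦
upperMdim P θ T f` is a real function on L¹(Ω, C(X)). It is convex, by Hölder's inequality for the
partition sums, and f ≤ g + c(ω) raises it by at most ∫ c dP, by invariance of P. Hahn–Banach then
yields a linear L with L f ≤ mdim(f) - mdim(0) (`exists_linear_le_of_convex`). Since f ≤ c(ω)
implies L f ≤ ∫ c dP, the functional L is positive and agrees with integration against P on
functions of ω, so by Riesz it is integration against a probability measure μ with marginal P
(`exists_measure_of_linear`).

Invariance of μ comes from coboundaries: the Birkhoff sums of g ∘ Θ - g telescope, their averages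
vanish in the limit, and mdim(g ∘ Θ - g) ≤ mdim(0), so L(g ∘ Θ) ≤ L g; replacing g by -g gives
equality. The bound on L now reads mdim(0) ≤ mdim(f) - ∫ f dμ for all f, that is F(μ) ≥ mdim(0),
while testing with f = 0 gives F ≤ mdim(0) for every measure.

The formula over 𝒜 is a normalisation: adding a constant to f shifts both mdim(f) and ∫ f dμ by that
constant. -/

namespace RandomMdim

/-! ### The space L¹(Ω, C(X)) -/

variable {Ω X : Type*}

/-- A function into a separable metric space is measurable if its distances to all points are. -/
lemma measurable_of_measurable_dist {Y : Type*} [MeasurableSpace Ω] [PseudoMetricSpace Y]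
    [SecondCountableTopology Y] [MeasurableSpace Y] [BorelSpace Y] {F : Ω → Y}
    (h : ∀ y, Measurable fun ω => dist (F ω) y) : Measurable F := by
  have hb : TopologicalSpace.IsTopologicalBasis
      {s : Set Y | ∃ y r, s = Metric.ball y r} := by
    refine TopologicalSpace.isTopologicalBasis_of_isOpen_of_nhds ?_ ?_
    · rintro _ ⟨y, r, rfl⟩
      exact Metric.isOpen_ball
    · intro a u ha hu
      obtain ⟨r, hr, hru⟩ := Metric.isOpen_iff.1 hu a ha
      exact ⟨_, ⟨a, r, rfl⟩, Metric.mem_ball_self hr, hru⟩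
  rw [BorelSpace.measurable_eq (α := Y), hb.borel_eq_generateFrom]
  refine measurable_generateFrom ?_
  rintro _ ⟨y, r, rfl⟩
  exact measurableSet_lt (h y) measurable_const

section Slice

variable [TopologicalSpace X]

/-- The map `ω ↦ f(ω, ·)` into `C(X, ℝ)`. -/
def slice (f : Ω × X → ℝ) (hf : ∀ ω, Continuous fun x => f (ω, x)) (ω : Ω) : C(X, ℝ) :=
  ⟨fun x => f (ω, x), hf ω⟩

@[simp]
lemma slice_apply (f : Ω × X → ℝ) (hf : ∀ ω, Continuous fun x => f (ω, x)) (ω : Ω) (x : X) :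
    slice f hf ω x = f (ω, x) := rfl

end Slice

variable [MeasurableSpace Ω] [MetricSpace X] [CompactSpace X] [Nonempty X] [MeasurableSpace X]
  [BorelSpace X] {P : Measure Ω} {f g : Ω × X → ℝ}

omit [BorelSpace X] in
-- C(X) is separable for compact metric X, so distances to fixed functions suffice; by continuity in
-- x each is tested on a dense sequence, which leaves countably many measurable conditions.
lemma stronglyMeasurable_slice (hm : Measurable f) (hf : ∀ ω, Continuous fun x => f (ω, x)) :
    StronglyMeasurable (slice f hf) := by
  borelize C(X, ℝ)
  refine Measurable.stronglyMeasurable (measurable_of_measurable_dist fun c => ?_)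
  refine measurable_of_Iic fun r => ?_
  have : (fun ω => dist (slice f hf ω) c) ⁻¹' Set.Iic r =
      ⋂ n, {ω | dist (f (ω, TopologicalSpace.denseSeq X n))
        (c (TopologicalSpace.denseSeq X n)) ≤ r} := by
    ext ω
    simp only [Set.mem_preimage, Set.mem_Iic, Set.mem_iInter, Set.mem_ofPred_eq]
    rw [ContinuousMap.dist_le_iff_of_nonempty]
    refine ⟨fun h n => h _, fun h x => ?_⟩
    have hcl : IsClosed {x | dist (slice f hf ω x) (c x) ≤ r} :=
      isClosed_le (by fun_prop) continuous_const
    exact (TopologicalSpace.denseRange_denseSeq X).induction_on (p := fun x =>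
      dist (slice f hf ω x) (c x) ≤ r) x hcl h
  rw [this]
  refine MeasurableSet.iInter fun n => measurableSet_le ?_ measurable_const
  exact (hm.comp (measurable_id.prodMk measurable_const)).dist measurable_const

/-- Viewing f as a Bochner integrable map into C(X) is what later allows approximation by compactly
supported continuous maps Ω → C(X). -/
lemma integrable_slice (hf : f ∈ (L1C P : Set (Ω × X → ℝ))) :
    Integrable (slice f hf.2.1) P := by
  refine ⟨(stronglyMeasurable_slice hf.1 hf.2.1).aestronglyMeasurable, ?_⟩
  simpa [HasFiniteIntegral, ContinuousMap.enorm_eq_iSup_enorm] using hf.2.2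

omit [MeasurableSpace Ω] [Nonempty X] [MeasurableSpace X] [BorelSpace X] in
lemma abs_le_norm_slice (hf : ∀ ω, Continuous fun x => f (ω, x)) (ω : Ω) (x : X) :
    |f (ω, x)| ≤ ‖slice f hf ω‖ := by
  simpa using (slice f hf ω).norm_coe_le_norm x

/-- Membership in `L¹(Ω, C(X))` is domination by an integrable function on the base. -/
lemma mem_L1C_iff : f ∈ (L1C P : Set (Ω × X → ℝ)) ↔ Measurable f ∧
    (∀ ω, Continuous fun x => f (ω, x)) ∧
      ∃ h : Ω → ℝ, Integrable h P ∧ ∀ ω x, |f (ω, x)| ≤ h ω := by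
  refine ⟨fun hf => ⟨hf.1, hf.2.1, _, (integrable_slice hf).norm, abs_le_norm_slice hf.2.1⟩, ?_⟩
  rintro ⟨hm, hc, h, hi, hle⟩
  refine ⟨hm, hc, lt_of_le_of_lt (lintegral_mono fun ω => ?_) hi.2⟩
  refine iSup_le fun x => ?_
  rw [enorm_le_iff_norm_le]
  exact (hle ω x).trans (le_abs_self _)

lemma add_mem_L1C (hf : f ∈ (L1C P : Set (Ω × X → ℝ))) (hg : g ∈ (L1C P : Set (Ω × X → ℝ))) :
    f + g ∈ (L1C P : Set (Ω × X → ℝ)) := by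
  rw [mem_L1C_iff] at *
  obtain ⟨hfm, hfc, h, hh, hfh⟩ := hf
  obtain ⟨hgm, hgc, k, hk, hgk⟩ := hg
  exact ⟨hfm.add hgm, fun ω => (hfc ω).add (hgc ω), h + k, hh.add hk, fun ω x =>
    (abs_add_le _ _).trans (add_le_add (hfh ω x) (hgk ω x))⟩

lemma smul_mem_L1C (c : ℝ) (hf : f ∈ (L1C P : Set (Ω × X → ℝ))) :
    c • f ∈ (L1C P : Set (Ω × X → ℝ)) := by
  rw [mem_L1C_iff] at *
  obtain ⟨hfm, hfc, h, hh, hfh⟩ := hf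
  refine ⟨hfm.const_smul c, fun ω => (hfc ω).const_smul c, |c| • h, hh.smul _, fun ω x => ?_⟩
  simp only [Pi.smul_apply, smul_eq_mul, abs_mul]
  exact mul_le_mul_of_nonneg_left (hfh ω x) (abs_nonneg c)

/-- A function of the base point alone. -/
lemma comp_fst_mem_L1C {c : Ω → ℝ} (hm : Measurable c) (hc : Integrable c P) :
    (fun p => c p.1) ∈ (L1C P : Set (Ω × X → ℝ)) :=
  mem_L1C_iff.2 ⟨hm.comp measurable_fst, fun ω => (continuous_const : Continuous fun _ : X => c ω),
    fun ω => |c ω|, hc.abs, fun _ _ => le_rfl⟩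

lemma const_mem_L1C [IsFiniteMeasure P] (c : ℝ) :
    (fun _ => c) ∈ (L1C P : Set (Ω × X → ℝ)) :=
  comp_fst_mem_L1C (c := fun _ => c) measurable_const (integrable_const c)

lemma bounded_mem_L1C [IsFiniteMeasure P] (hm : Measurable f)
    (hc : ∀ ω, Continuous fun x => f (ω, x)) (C : ℝ) (hC : ∀ p, |f p| ≤ C) :
    f ∈ (L1C P : Set (Ω × X → ℝ)) :=
  mem_L1C_iff.2 ⟨hm, hc, fun _ => C, integrable_const C, fun _ _ => hC _⟩

lemma comp_skew_mem_L1C {θ : Ω → Ω} {T : Ω → X → X} (hθ : MeasurePreserving θ P P)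
    (hT : IsContinuousRDS T) (hf : f ∈ (L1C P : Set (Ω × X → ℝ))) :
    f ∘ skew θ T ∈ (L1C P : Set (Ω × X → ℝ)) := by
  rw [mem_L1C_iff] at *
  obtain ⟨hfm, hfc, h, hh, hfh⟩ := hf
  exact ⟨hfm.comp ((hθ.measurable.comp measurable_fst).prodMk hT.measurable),
    fun ω => (hfc (θ ω)).comp (hT.continuous ω), h ∘ θ, hθ.integrable_comp_of_integrable hh,
    fun ω x => hfh _ _⟩

lemma integrable_of_mem_marginalMeasures {μ : Measure (Ω × X)}
    (hμ : μ.map Prod.fst = P) (hf : f ∈ (L1C P : Set (Ω × X → ℝ))) : Integrable f μ := by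
  obtain ⟨hfm, -, h, hh, hfh⟩ := mem_L1C_iff.1 hf
  have : Integrable (fun p : Ω × X => h p.1) μ := by
    rw [← hμ] at hh
    exact hh.comp_measurable measurable_fst
  exact this.mono' hfm.aestronglyMeasurable (ae_of_all _ fun p => hfh p.1 p.2)

variable (X P) in
/-- The space `L¹(Ω, C(X))` as a submodule. -/
def L1CSubmodule [IsFiniteMeasure P] : Submodule ℝ (Ω × X → ℝ) where
  carrier := L1C P
  add_mem' := add_mem_L1C
  zero_mem' := const_mem_L1C 0
  smul_mem' c _ hf := smul_mem_L1C c hf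

end RandomMdim

/-! ### Fibre iterates and Birkhoff sums -/

namespace RandomMdim

variable {Ω X : Type*} {θ : Ω → Ω} {T : Ω → X → X}

lemma measurable_iter [MeasurableSpace Ω] [TopologicalSpace X] [MeasurableSpace X]
    (hθ : Measurable θ) (hT : IsContinuousRDS T) (n : ℕ) :
    Measurable fun p : Ω × X => iter θ T n p.1 p.2 := by
  induction n with
  | zero => exact measurable_snd
  | succ n ih => exact hT.measurable.comp (((hθ.iterate n).comp measurable_fst).prodMk ih)

lemma continuous_iter [MeasurableSpace Ω] [TopologicalSpace X] [MeasurableSpace X]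
    (hT : IsContinuousRDS T) (n : ℕ) (ω : Ω) : Continuous fun x => iter θ T n ω x := by
  induction n with
  | zero => exact continuous_id
  | succ n ih => exact (hT.continuous _).comp ih

lemma skew_iterate (n : ℕ) (ω : Ω) (x : X) :
    (skew θ T)^[n] (ω, x) = (θ^[n] ω, iter θ T n ω x) := by
  induction n with
  | zero => rfl
  | succ n ih => rw [Function.iterate_succ_apply', ih, Function.iterate_succ_apply']; rfl

section Birkhoff

variable (θ T)

lemma birkhoff_add (f g : Ω × X → ℝ) (n : ℕ) (ω : Ω) (x : X) :
    birkhoff θ T (f + g) n ω x = birkhoff θ T f n ω x + birkhoff θ T g n ω x :=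
  Finset.sum_add_distrib

lemma birkhoff_smul (c : ℝ) (f : Ω × X → ℝ) (n : ℕ) (ω : Ω) (x : X) :
    birkhoff θ T (c • f) n ω x = c * birkhoff θ T f n ω x :=
  (Finset.mul_sum _ _ _).symm

lemma birkhoff_le_add {f g : Ω × X → ℝ} {c : Ω → ℝ} (h : ∀ ω x, f (ω, x) ≤ g (ω, x) + c ω)
    (n : ℕ) (ω : Ω) (x : X) :
    birkhoff θ T f n ω x ≤ birkhoff θ T g n ω x + ∑ j ∈ Finset.range n, c (θ^[j] ω) := by
  rw [birkhoff, birkhoff, ← Finset.sum_add_distrib]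
  exact Finset.sum_le_sum fun j _ => h _ _

lemma abs_birkhoff_le {f : Ω × X → ℝ} {h : Ω → ℝ} (hf : ∀ ω x, |f (ω, x)| ≤ h ω)
    (n : ℕ) (ω : Ω) (x : X) :
    |birkhoff θ T f n ω x| ≤ ∑ j ∈ Finset.range n, h (θ^[j] ω) :=
  (Finset.abs_sum_le_sum_abs _ _).trans (Finset.sum_le_sum fun _ _ => hf _ _)

lemma birkhoff_coboundary (g : Ω × X → ℝ) (n : ℕ) (ω : Ω) (x : X) :
    birkhoff θ T (g ∘ skew θ T - g) n ω x = g (θ^[n] ω, iter θ T n ω x) - g (ω, x) := by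
  have := Finset.sum_range_sub (fun j => g (θ^[j] ω, iter θ T j ω x)) n
  refine Eq.trans (Finset.sum_congr rfl fun j _ => ?_) this
  simp only [Pi.sub_apply, Function.comp_apply, ← skew_iterate, ← Function.iterate_succ_apply']

end Birkhoff

/-! ### Counting separated sets -/

section Bowen

variable [PseudoMetricSpace X] {n : ℕ} {ω : Ω} {ε : ℝ}

lemma lt_bowenDist_iff (hε : 0 ≤ ε) {x y : X} : ε < bowenDist θ T n ω x y ↔
    ∃ j : Fin n, ε < dist (iter θ T j ω x) (iter θ T j ω y) := by
  -- For n = 0 the supremum over the empty index type is 0 by convention, so 0 ≤ ε makes both sides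
  -- false.
  rcases n.eq_zero_or_pos with rfl | hn
  · simp [bowenDist, hε]
  · have : Nonempty (Fin n) := ⟨⟨0, hn⟩⟩
    exact lt_ciSup_iff (Set.finite_range _).bddAbove

lemma isSep_singleton (x : X) : IsSep θ T n ω ε {x} := by
  intro a ha b hb hab
  rw [Finset.mem_singleton] at ha hb
  exact absurd (ha.trans hb.symm) hab

variable (X) in
/-- Separated sets of order `n` have at most `N ^ n` elements. -/
lemma exists_card_le_pow [CompactSpace X] [Nonempty X] (hε : 0 < ε) : ∃ N : ℕ, 1 ≤ N ∧
    ∀ (θ : Ω → Ω) (T : Ω → X → X) n ω F, IsSep θ T n ω ε F → F.card ≤ N ^ n := by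
  obtain ⟨t, -, htf, ht⟩ := Metric.finite_approx_of_totallyBounded
    (isCompact_univ (X := X)).totallyBounded (ε / 2) (half_pos hε)
  have hc : ∀ x : X, ∃ c : t, dist x c < ε / 2 := fun x => by
    simpa using ht (Set.mem_univ x)
  choose c hc using hc
  have := htf.fintype
  have : Nonempty t := ⟨c (Classical.arbitrary X)⟩
  refine ⟨Fintype.card t, Fintype.card_pos, fun θ T n ω F hF => ?_⟩
  -- Points with the same itinerary through the (ε/2)-net stay within ε of each other at all times,
  -- so a separated set injects into the itineraries of length n.
  have hinj : Set.InjOn (fun x => fun j : Fin n => c (iter θ T j ω x)) F := by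
    intro x hx y hy hxy
    by_contra hne
    obtain ⟨j, hj⟩ := (lt_bowenDist_iff hε.le).1 (hF x hx y hy hne)
    have h1 := hc (iter θ T j ω x)
    have h2 := hc (iter θ T j ω y)
    have hxy' : c (iter θ T j ω x) = c (iter θ T j ω y) := congrFun hxy j
    rw [← hxy', dist_comm] at h2
    linarith [dist_triangle (iter θ T j ω x) (c (iter θ T j ω x)) (iter θ T j ω y)]
  classical
  calc F.card = (F.image _).card := (Finset.card_image_of_injOn hinj).symm
    _ ≤ Fintype.card (Fin n → t) := Finset.card_le_univ _
    _ = Fintype.card t ^ n := by simp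

end Bowen

/-! ### Pointwise estimates for the partition sums -/

section SepSum

variable [PseudoMetricSpace X] {f g : Ω × X → ℝ} {n : ℕ} {ω : Ω} {ε : ℝ}

lemma one_lt_one_div_of_pos (h0 : 0 < ε) (h1 : ε < 1) : 1 < 1 / ε := by
  rw [one_div]; exact (one_lt_inv₀ h0).2 h1

lemma log_one_div_pos (h0 : 0 < ε) (h1 : ε < 1) : 0 < Real.log (1 / ε) :=
  Real.log_pos (one_lt_one_div_of_pos h0 h1)

omit [PseudoMetricSpace X] in
lemma sum_le_card_mul (h0 : 0 < ε) (h1 : ε < 1) {H : ℝ}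
    (hH : ∀ x, birkhoff θ T f n ω x ≤ H) (F : Finset X) :
    ∑ x ∈ F, (1 / ε) ^ birkhoff θ T f n ω x ≤ F.card * (1 / ε) ^ H := by
  rw [← nsmul_eq_mul]
  exact Finset.sum_le_card_nsmul _ _ _ fun x _ =>
    Real.rpow_le_rpow_of_exponent_le (one_lt_one_div_of_pos h0 h1).le (hH x)

variable [CompactSpace X]

lemma bddAbove_sepSum (h0 : 0 < ε) (h1 : ε < 1) {H : ℝ} (hH : ∀ x, birkhoff θ T f n ω x ≤ H) :
    BddAbove {s : ℝ | ∃ F : Finset X, IsSep θ T n ω ε F ∧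
      s = ∑ x ∈ F, (1 / ε) ^ birkhoff θ T f n ω x} := by
  cases isEmpty_or_nonempty X
  · refine ⟨0, ?_⟩
    rintro _ ⟨F, -, rfl⟩
    simp [Finset.eq_empty_of_isEmpty F]
  obtain ⟨N, -, hN⟩ := exists_card_le_pow (Ω := Ω) X h0
  refine ⟨(N : ℝ) ^ n * (1 / ε) ^ H, ?_⟩
  rintro _ ⟨F, hF, rfl⟩
  refine (sum_le_card_mul h0 h1 hH F).trans ?_
  gcongr
  exact_mod_cast hN θ T n ω F hF

omit [CompactSpace X] in
lemma sepSum_le {C : ℝ}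
    (h : ∀ F, IsSep θ T n ω ε F → ∑ x ∈ F, (1 / ε) ^ birkhoff θ T f n ω x ≤ C) :
    sepSum θ T f n ω ε ≤ C := by
  refine csSup_le ⟨0, ∅, fun x hx => absurd hx (Finset.notMem_empty x), by simp⟩ ?_
  rintro _ ⟨F, hF, rfl⟩
  exact h F hF

lemma le_sepSum (h0 : 0 < ε) (h1 : ε < 1) {H : ℝ} (hH : ∀ x, birkhoff θ T f n ω x ≤ H)
    {F : Finset X} (hF : IsSep θ T n ω ε F) :
    ∑ x ∈ F, (1 / ε) ^ birkhoff θ T f n ω x ≤ sepSum θ T f n ω ε :=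
  le_csSup (bddAbove_sepSum h0 h1 hH) ⟨F, hF, rfl⟩

lemma rpow_le_sepSum (h0 : 0 < ε) (h1 : ε < 1) {H : ℝ} (hH : ∀ x, birkhoff θ T f n ω x ≤ H)
    (x : X) : (1 / ε) ^ birkhoff θ T f n ω x ≤ sepSum θ T f n ω ε := by
  simpa using le_sepSum h0 h1 hH (isSep_singleton x)

variable [Nonempty X]

lemma sepSum_pos (h0 : 0 < ε) (h1 : ε < 1) {H : ℝ} (hH : ∀ x, birkhoff θ T f n ω x ≤ H) :
    0 < sepSum θ T f n ω ε :=
  (Real.rpow_pos_of_pos (one_div_pos.2 h0) _).trans_le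
    (rpow_le_sepSum h0 h1 hH (Classical.arbitrary X))

/-- Singletons are separated, which bounds the sum below; the cardinality bound times the largest
weight bounds it above. -/
lemma abs_log_sepSum_le {N : ℕ} (hN1 : 1 ≤ N)
    (hN : ∀ F : Finset X, IsSep θ T n ω ε F → F.card ≤ N ^ n)
    (h0 : 0 < ε) (h1 : ε < 1) {H : ℝ} (hH : ∀ x, |birkhoff θ T f n ω x| ≤ H) :
    |Real.log (sepSum θ T f n ω ε)| ≤ n * Real.log N + H * Real.log (1 / ε) := by
  have hb : 0 < 1 / ε := one_div_pos.2 h0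
  have hH' : ∀ x, birkhoff θ T f n ω x ≤ H := fun x => (le_abs_self _).trans (hH x)
  have hpos := sepSum_pos h0 h1 hH'
  have hN0 : (0 : ℝ) < N := by exact_mod_cast hN1
  have hlogN : 0 ≤ n * Real.log N :=
    mul_nonneg n.cast_nonneg (Real.log_nonneg (by exact_mod_cast hN1))
  rw [abs_le]
  constructor
  · have := Real.log_le_log (Real.rpow_pos_of_pos hb _)
      (rpow_le_sepSum h0 h1 hH' (Classical.arbitrary X))
    rw [Real.log_rpow hb] at this
    have h2 := mul_le_mul_of_nonneg_right (neg_le_of_abs_le (hH (Classical.arbitrary X)))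
      (log_one_div_pos h0 h1).le
    linarith
  · have : sepSum θ T f n ω ε ≤ (N : ℝ) ^ n * (1 / ε) ^ H := sepSum_le fun F hF => by
      refine (sum_le_card_mul h0 h1 hH' F).trans ?_
      gcongr
      exact_mod_cast hN F hF
    have := Real.log_le_log hpos this
    rwa [Real.log_mul (by positivity) (Real.rpow_pos_of_pos hb _).ne', Real.log_pow,
      Real.log_rpow hb] at this

lemma log_sepSum_le_add (h0 : 0 < ε) (h1 : ε < 1) {H C : ℝ}
    (hH : ∀ x, birkhoff θ T g n ω x ≤ H)
    (h : ∀ x, birkhoff θ T f n ω x ≤ birkhoff θ T g n ω x + C) :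
    Real.log (sepSum θ T f n ω ε) ≤ Real.log (sepSum θ T g n ω ε) + C * Real.log (1 / ε) := by
  have hb : 0 < 1 / ε := one_div_pos.2 h0
  have hf : ∀ x, birkhoff θ T f n ω x ≤ H + C := fun x =>
    (h x).trans (add_le_add_left (hH x) C)
  have key : sepSum θ T f n ω ε ≤ sepSum θ T g n ω ε * (1 / ε) ^ C := sepSum_le fun F hF => by
    refine le_trans ?_ (mul_le_mul_of_nonneg_right (le_sepSum h0 h1 hH hF)
      (Real.rpow_pos_of_pos hb _).le)
    rw [Finset.sum_mul]
    refine Finset.sum_le_sum fun x _ => ?_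
    rw [← Real.rpow_add hb]
    exact Real.rpow_le_rpow_of_exponent_le (one_lt_one_div_of_pos h0 h1).le (h x)
  have := Real.log_le_log (sepSum_pos h0 h1 hf) key
  rwa [Real.log_mul (sepSum_pos h0 h1 hH).ne' (Real.rpow_pos_of_pos hb _).ne',
    Real.log_rpow hb] at this

/-- This is Hölder's inequality with exponents 1/s and 1/t on each separated set, which is where
convexity of the mean dimension originates. -/
lemma log_sepSum_convex (h0 : 0 < ε) (h1 : ε < 1) {H K s t : ℝ}
    (hH : ∀ x, birkhoff θ T f n ω x ≤ H) (hK : ∀ x, birkhoff θ T g n ω x ≤ K)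
    (hs : 0 ≤ s) (ht : 0 ≤ t) (hst : s + t = 1) :
    Real.log (sepSum θ T (s • f + t • g) n ω ε) ≤
      s * Real.log (sepSum θ T f n ω ε) + t * Real.log (sepSum θ T g n ω ε) := by
  have hb : 0 < 1 / ε := one_div_pos.2 h0
  set A := sepSum θ T f n ω ε with hA
  set B := sepSum θ T g n ω ε with hB
  have hA0 : 0 < A := sepSum_pos h0 h1 hH
  have hB0 : 0 < B := sepSum_pos h0 h1 hK
  have hfg : ∀ x, birkhoff θ T (s • f + t • g) n ω x ≤ s * H + t * K := fun x => by
    rw [birkhoff_add, birkhoff_smul, birkhoff_smul]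
    exact add_le_add (mul_le_mul_of_nonneg_left (hH x) hs) (mul_le_mul_of_nonneg_left (hK x) ht)
  have key : sepSum θ T (s • f + t • g) n ω ε ≤ A ^ s * B ^ t := sepSum_le fun F hF => by
    -- After dividing the weights by A and B, weighted AM-GM applies term by term; each normalised
    -- sum over F is at most 1.
    have hterm : ∀ x ∈ F, (1 / ε) ^ birkhoff θ T (s • f + t • g) n ω x ≤
        A ^ s * B ^ t * (s * ((1 / ε) ^ birkhoff θ T f n ω x / A) +
          t * ((1 / ε) ^ birkhoff θ T g n ω x / B)) := fun x _ => by
      have hu := (Real.rpow_pos_of_pos hb (birkhoff θ T f n ω x)).le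
      have hv := (Real.rpow_pos_of_pos hb (birkhoff θ T g n ω x)).le
      have hm := Real.geom_mean_le_arith_mean2_weighted hs ht
        (div_nonneg hu hA0.le) (div_nonneg hv hB0.le) hst
      refine le_trans (le_of_eq ?_) (mul_le_mul_of_nonneg_left hm (by positivity))
      rw [Real.div_rpow hu hA0.le, Real.div_rpow hv hB0.le, birkhoff_add, birkhoff_smul,
        birkhoff_smul, Real.rpow_add hb, mul_comm s, mul_comm t, Real.rpow_mul hb.le,
        Real.rpow_mul hb.le]
      have := (Real.rpow_pos_of_pos hA0 s).ne'
      have := (Real.rpow_pos_of_pos hB0 t).ne'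
      field_simp
    refine (Finset.sum_le_sum hterm).trans ?_
    rw [← Finset.mul_sum, Finset.sum_add_distrib, ← Finset.mul_sum, ← Finset.mul_sum,
      ← Finset.sum_div, ← Finset.sum_div]
    refine mul_le_of_le_one_right (by positivity) ?_
    have e1 := (div_le_one hA0).2 (le_sepSum h0 h1 hH hF)
    have e2 := (div_le_one hB0).2 (le_sepSum h0 h1 hK hF)
    calc _ ≤ s * 1 + t * 1 :=
          add_le_add (mul_le_mul_of_nonneg_left e1 hs) (mul_le_mul_of_nonneg_left e2 ht)
      _ = 1 := by linarith
  have := Real.log_le_log (sepSum_pos h0 h1 hfg) key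
  rwa [Real.log_mul (by positivity) (by positivity), Real.log_rpow hA0, Real.log_rpow hB0] at this

end SepSum

/-! ### Measurability and integrability in ω -/

section Measurability

variable [MeasurableSpace Ω] [MetricSpace X] [CompactSpace X] [MeasurableSpace X]
  [BorelSpace X] {f : Ω × X → ℝ} {ε : ℝ}

omit [CompactSpace X] [BorelSpace X] in
lemma measurable_birkhoff (hθ : Measurable θ) (hT : IsContinuousRDS T) (hf : Measurable f)
    (n : ℕ) (x : X) : Measurable fun ω => birkhoff θ T f n ω x := by
  refine Finset.measurable_fun_sum _ fun j _ => hf.comp ((hθ.iterate j).prodMk ?_)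
  exact (measurable_iter hθ hT j).comp (measurable_id.prodMk measurable_const)

omit [CompactSpace X] [BorelSpace X] in
lemma continuous_birkhoff (hT : IsContinuousRDS T) (hf : ∀ ω, Continuous fun x => f (ω, x))
    (n : ℕ) (ω : Ω) : Continuous fun x => birkhoff θ T f n ω x :=
  continuous_finsetSum _ fun j _ => (hf _).comp (continuous_iter hT j ω)

/-- The tuples `x` that enumerate a separated set whose weight exceeds `a`. -/
def heavyTuples (θ : Ω → Ω) (T : Ω → X → X) (f : Ω × X → ℝ) (n : ℕ) (ω : Ω) (ε a : ℝ) (k : ℕ) :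
    Set (Fin k → X) :=
  {x | (∀ i j, i ≠ j → ∃ l : Fin n, ε < dist (iter θ T l ω (x i)) (iter θ T l ω (x j))) ∧
    a < ∑ i, (1 / ε) ^ birkhoff θ T f n ω (x i)}

lemma isOpen_heavyTuples (hT : IsContinuousRDS T) (hf : ∀ ω, Continuous fun x => f (ω, x))
    (hε : 0 < ε) (n : ℕ) (ω : Ω) (a : ℝ) (k : ℕ) :
    IsOpen (heavyTuples θ T f n ω ε a k) := by
  simp only [heavyTuples, Set.ofPred_and, Set.ofPred_forall, Set.ofPred_exists]
  refine IsOpen.inter ?_ ?_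
  · refine isOpen_iInter_of_finite fun i => isOpen_iInter_of_finite fun j =>
      isOpen_iInter_of_finite fun _ => isOpen_iUnion fun l => isOpen_lt continuous_const ?_
    exact ((continuous_iter hT l ω).comp (continuous_apply i)).dist
      ((continuous_iter hT l ω).comp (continuous_apply j))
  · refine isOpen_lt continuous_const (continuous_finsetSum _ fun i _ => ?_)
    exact continuous_const.rpow ((continuous_birkhoff hT hf n ω).comp (continuous_apply i))
      fun _ => Or.inl (one_div_pos.2 hε).ne'

lemma measurableSet_heavyTuples (hθ : Measurable θ) (hT : IsContinuousRDS T) (hf : Measurable f)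
    (n : ℕ) (a : ℝ) {k : ℕ} (x : Fin k → X) :
    MeasurableSet {ω | x ∈ heavyTuples θ T f n ω ε a k} := by
  change MeasurableSet {ω | (∀ i j, i ≠ j →
    ∃ l : Fin n, ε < dist (iter θ T l ω (x i)) (iter θ T l ω (x j))) ∧
      a < ∑ i, (1 / ε) ^ birkhoff θ T f n ω (x i)}
  simp only [Set.ofPred_and, Set.ofPred_forall, Set.ofPred_exists]
  have hi : ∀ (l : Fin n) (i : Fin k), Measurable fun ω => iter θ T l ω (x i) := fun l i =>
    (measurable_iter hθ hT l).comp (measurable_id.prodMk measurable_const)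
  refine MeasurableSet.inter ?_ ?_
  · exact MeasurableSet.iInter fun i => MeasurableSet.iInter fun j =>
      MeasurableSet.iInter fun _ : i ≠ j => MeasurableSet.iUnion fun l =>
        measurableSet_lt measurable_const ((hi l i).dist (hi l j))
  · refine measurableSet_lt measurable_const (Finset.measurable_fun_sum _ fun i _ => ?_)
    exact measurable_const.pow (measurable_birkhoff hθ hT hf n (x i))

omit [MeasurableSpace Ω] [MeasurableSpace X] [BorelSpace X] in
lemma lt_sepSum_iff (h0 : 0 < ε) (h1 : ε < 1) {n : ℕ} {ω : Ω} {H : ℝ}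
    (hH : ∀ x, birkhoff θ T f n ω x ≤ H) (a : ℝ) :
    a < sepSum θ T f n ω ε ↔ ∃ k, (heavyTuples θ T f n ω ε a k).Nonempty := by
  constructor
  · intro h
    obtain ⟨_, ⟨F, hF, rfl⟩, hlt⟩ := exists_lt_of_lt_csSup
      (by exact ⟨0, ∅, fun x hx => absurd hx (Finset.notMem_empty x), by simp⟩) h
    refine ⟨F.card, fun i => F.equivFin.symm i, fun i j hij => ?_, ?_⟩
    · refine (lt_bowenDist_iff h0.le).1 (hF _ (F.equivFin.symm i).2 _ (F.equivFin.symm j).2 ?_)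
      exact fun he => hij (F.equivFin.symm.injective (Subtype.ext he))
    · rwa [F.equivFin.symm.sum_comp fun y => (1 / ε) ^ birkhoff θ T f n ω (y : X),
        Finset.sum_coe_sort F fun y => (1 / ε) ^ birkhoff θ T f n ω y]
  · rintro ⟨k, x, hx, ha⟩
    have hinj : Function.Injective x := by
      intro i j hij
      by_contra hne
      obtain ⟨l, hl⟩ := hx i j hne
      rw [hij, dist_self] at hl
      exact absurd hl h0.not_gt
    have hsep : IsSep θ T n ω ε (Finset.univ.map ⟨x, hinj⟩) := by
      intro y hy z hz hyz
      simp only [Finset.mem_map, Finset.mem_univ, Function.Embedding.coeFn_mk, true_and] at hy hz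
      obtain ⟨i, rfl⟩ := hy
      obtain ⟨j, rfl⟩ := hz
      exact (lt_bowenDist_iff h0.le).2 (hx i j fun h => hyz (congrArg x h))
    refine ha.trans_le ?_
    have := le_sepSum h0 h1 hH hsep
    rwa [Finset.sum_map] at this

variable [Nonempty X]

/-- The heavy tuples form an open set, being cut out by strict inequalities in continuous functions.
It is therefore nonempty exactly when it meets a fixed countable dense set of tuples, and superlevel
sets become countable unions. -/
lemma measurable_sepSum (hθ : Measurable θ) (hT : IsContinuousRDS T) (hf : Measurable f)
    (hfc : ∀ ω, Continuous fun x => f (ω, x)) {h : Ω → ℝ} (hh : ∀ ω x, |f (ω, x)| ≤ h ω)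
    (h0 : 0 < ε) (h1 : ε < 1) (n : ℕ) : Measurable fun ω => sepSum θ T f n ω ε := by
  refine measurable_of_Ioi fun a => ?_
  have : (fun ω => sepSum θ T f n ω ε) ⁻¹' Set.Ioi a = ⋃ k : ℕ, ⋃ m : Fin k → ℕ,
      {ω | (fun i => TopologicalSpace.denseSeq X (m i)) ∈ heavyTuples θ T f n ω ε a k} := by
    ext ω
    have hH : ∀ x, birkhoff θ T f n ω x ≤ _ := fun x =>
      (le_abs_self _).trans (abs_birkhoff_le θ T hh n ω x)
    simp only [Set.mem_preimage, Set.mem_Ioi, Set.mem_iUnion, lt_sepSum_iff h0 h1 hH]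
    refine exists_congr fun k => ⟨fun hne => ?_, fun ⟨m, hm⟩ => ⟨_, hm⟩⟩
    have hd : DenseRange (Pi.map fun (_ : Fin k) => TopologicalSpace.denseSeq X) :=
      DenseRange.piMap fun _ => TopologicalSpace.denseRange_denseSeq X
    exact hd.exists_mem_open (isOpen_heavyTuples hT hfc h0 n ω a k) hne
  rw [this]
  exact MeasurableSet.iUnion fun k => MeasurableSet.iUnion fun m =>
    measurableSet_heavyTuples hθ hT hf n a _

lemma integrable_log_sepSum {P : Measure Ω} [IsFiniteMeasure P] (hθ : MeasurePreserving θ P P)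
    (hT : IsContinuousRDS T) (hf : f ∈ (L1C P : Set (Ω × X → ℝ)))
    (h0 : 0 < ε) (h1 : ε < 1) (n : ℕ) :
    Integrable (fun ω => Real.log (sepSum θ T f n ω ε)) P := by
  obtain ⟨hfm, hfc, h, hh, hle⟩ := mem_L1C_iff.1 hf
  obtain ⟨N, hN1, hN⟩ := exists_card_le_pow (Ω := Ω) X h0
  have hi : Integrable (fun ω => n * Real.log N +
      (∑ j ∈ Finset.range n, h (θ^[j] ω)) * Real.log (1 / ε)) P :=
    (integrable_const _).add ((integrable_finsetSum _ fun j _ =>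
      (hθ.iterate j).integrable_comp_of_integrable hh).mul_const _)
  refine hi.mono' ((measurable_sepSum hθ.measurable hT hfm hfc hle h0
    h1 n).log.aestronglyMeasurable) (ae_of_all _ fun ω => ?_)
  exact abs_log_sepSum_le hN1 (hN θ T n ω) h0 h1 (abs_birkhoff_le θ T hle n ω)

end Measurability

end RandomMdim

/-! ### The mean dimension as a convex functional -/

namespace RandomMdim

variable {Ω X : Type*} [MeasurableSpace Ω] {P : Measure Ω} {θ : Ω → Ω} {T : Ω → X → X}
  {f g : Ω × X → ℝ}

lemma eventually_mem_Ioo : ∀ᶠ ε : ℝ in 𝓝[>] 0, ε ∈ Set.Ioo (0 : ℝ) 1 :=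
  Ioo_mem_nhdsGT one_pos

section Rate

variable [PseudoMetricSpace X]

variable (P θ T f) in
/-- For all small `ε`, the averages in the definition of the pressure at scale `ε` are eventually
at most `A log(1/ε)`. -/
def HasRate (A : ℝ) : Prop :=
  ∀ᶠ ε : ℝ in 𝓝[>] 0, ∀ᶠ n : ℕ in atTop,
    (1 / (n : ℝ)) * ∫ ω, Real.log (sepSum θ T f n ω ε) ∂P ≤ A * Real.log (1 / ε)

/-- Together with `hasRate_of_upperMdim_lt` this makes the mean dimension the infimum of its real
rates, so that inequalities between iterated limsups reduce to eventual inequalities at fixed ε and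
n. -/
lemma upperMdim_le_of_hasRate {A : ℝ} (h : HasRate P θ T f A) :
    upperMdim P θ T f ≤ (A : EReal) := by
  refine limsup_le_of_le (h := ?_)
  filter_upwards [h, eventually_mem_Ioo] with ε hε hε1
  have hlog := log_one_div_pos hε1.1 hε1.2
  rw [EReal.div_le_iff_le_mul (by exact_mod_cast hlog) (EReal.coe_ne_top _), mul_comm,
    ← EReal.coe_mul]
  refine limsup_le_of_le (h := ?_)
  filter_upwards [hε] with n hn
  exact_mod_cast hn

lemma hasRate_of_upperMdim_lt {A : ℝ} (h : upperMdim P θ T f < (A : EReal)) :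
    HasRate P θ T f A := by
  filter_upwards [eventually_lt_of_limsup_lt h, eventually_mem_Ioo] with ε hε hε1
  have hlog := log_one_div_pos hε1.1 hε1.2
  rw [EReal.div_lt_iff (by exact_mod_cast hlog) (EReal.coe_ne_top _), ← EReal.coe_mul] at hε
  filter_upwards [eventually_lt_of_limsup_lt hε] with n hn
  exact_mod_cast hn.le

end Rate

variable [MetricSpace X] [CompactSpace X] [Nonempty X] [MeasurableSpace X] [BorelSpace X]
  [IsFiniteMeasure P]

lemma HasRate.of_birkhoff_le (hθ : MeasurePreserving θ P P) (hT : IsContinuousRDS T)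
    (hf : f ∈ (L1C P : Set (Ω × X → ℝ))) (hg : g ∈ (L1C P : Set (Ω × X → ℝ)))
    {c : ℕ → Ω → ℝ} (hc : ∀ n, Integrable (c n) P)
    (h : ∀ n ω x, birkhoff θ T f n ω x ≤ birkhoff θ T g n ω x + c n ω) {C : ℝ}
    (hC : Tendsto (fun n : ℕ => (1 / (n : ℝ)) * ∫ ω, c n ω ∂P) atTop (𝓝 C)) {A B : ℝ}
    (hA : HasRate P θ T g A) (hAB : A + C < B) : HasRate P θ T f B := by
  obtain ⟨-, -, k, -, hk⟩ := mem_L1C_iff.1 hg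
  filter_upwards [hA, eventually_mem_Ioo] with ε hε ⟨h0, h1⟩
  have hlog := log_one_div_pos h0 h1
  filter_upwards [hε, hC.eventually_lt_const (show C < B - A by linarith)] with n hn hn'
  have hint : ∫ ω, Real.log (sepSum θ T f n ω ε) ∂P ≤
      ∫ ω, Real.log (sepSum θ T g n ω ε) ∂P + (∫ ω, c n ω ∂P) * Real.log (1 / ε) := by
    rw [← integral_mul_const, ← integral_add (integrable_log_sepSum hθ hT hg h0 h1 n)
      ((hc n).mul_const _)]
    refine integral_mono (integrable_log_sepSum hθ hT hf h0 h1 n)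
      ((integrable_log_sepSum hθ hT hg h0 h1 n).add ((hc n).mul_const _)) fun ω => ?_
    exact log_sepSum_le_add h0 h1
      (fun x => (le_abs_self _).trans (abs_birkhoff_le θ T hk n ω x)) (h n ω)
  have hn0 : (0 : ℝ) ≤ 1 / n := by positivity
  have := mul_le_mul_of_nonneg_left hint hn0
  have := mul_le_mul_of_nonneg_right hn'.le hlog.le
  linarith

lemma HasRate.convex (hθ : MeasurePreserving θ P P) (hT : IsContinuousRDS T)
    (hf : f ∈ (L1C P : Set (Ω × X → ℝ))) (hg : g ∈ (L1C P : Set (Ω × X → ℝ)))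
    {s t A B : ℝ} (hs : 0 ≤ s) (ht : 0 ≤ t) (hst : s + t = 1)
    (hA : HasRate P θ T f A) (hB : HasRate P θ T g B) :
    HasRate P θ T (s • f + t • g) (s * A + t * B) := by
  obtain ⟨-, -, h, -, hh⟩ := mem_L1C_iff.1 hf
  obtain ⟨-, -, k, -, hk⟩ := mem_L1C_iff.1 hg
  filter_upwards [hA, hB, eventually_mem_Ioo] with ε hε hε' ⟨h0, h1⟩
  filter_upwards [hε, hε'] with n hn hn'
  have hfi := (integrable_log_sepSum hθ hT hf h0 h1 n).const_mul s
  have hgi := (integrable_log_sepSum hθ hT hg h0 h1 n).const_mul t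
  have hint : ∫ ω, Real.log (sepSum θ T (s • f + t • g) n ω ε) ∂P ≤
      s * ∫ ω, Real.log (sepSum θ T f n ω ε) ∂P + t * ∫ ω, Real.log (sepSum θ T g n ω ε) ∂P := by
    rw [← integral_const_mul, ← integral_const_mul, ← integral_add hfi hgi]
    refine integral_mono (integrable_log_sepSum hθ hT
      (add_mem_L1C (smul_mem_L1C s hf) (smul_mem_L1C t hg)) h0 h1 n) (hfi.add hgi) fun ω => ?_
    exact log_sepSum_convex h0 h1
      (fun x => (le_abs_self _).trans (abs_birkhoff_le θ T hh n ω x))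
      (fun x => (le_abs_self _).trans (abs_birkhoff_le θ T hk n ω x)) hs ht hst
  have hn0 : (0 : ℝ) ≤ 1 / n := by positivity
  have := mul_le_mul_of_nonneg_left hint hn0
  have := mul_le_mul_of_nonneg_left hn hs
  have := mul_le_mul_of_nonneg_left hn' ht
  linarith

lemma upperMdim_le_add_of_birkhoff_le (hθ : MeasurePreserving θ P P) (hT : IsContinuousRDS T)
    (hf : f ∈ (L1C P : Set (Ω × X → ℝ))) (hg : g ∈ (L1C P : Set (Ω × X → ℝ)))
    {c : ℕ → Ω → ℝ} (hc : ∀ n, Integrable (c n) P)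
    (h : ∀ n ω x, birkhoff θ T f n ω x ≤ birkhoff θ T g n ω x + c n ω) {C : ℝ}
    (hC : Tendsto (fun n : ℕ => (1 / (n : ℝ)) * ∫ ω, c n ω ∂P) atTop (𝓝 C)) :
    upperMdim P θ T f ≤ upperMdim P θ T g + (C : EReal) := by
  refine EReal.le_of_forall_lt_iff_le.1 fun B hB => ?_
  rw [← EReal.lt_sub_iff_add_lt (.inl (EReal.coe_ne_bot _)) (.inl (EReal.coe_ne_top _)),
    EReal.lt_iff_exists_real_btwn] at hB
  obtain ⟨A, hA, hAB⟩ := hB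
  refine upperMdim_le_of_hasRate
    ((hasRate_of_upperMdim_lt hA).of_birkhoff_le hθ hT hf hg hc h hC ?_)
  have : A < B - C := by exact_mod_cast hAB
  linarith

lemma upperMdim_le_add (hθ : MeasurePreserving θ P P) (hT : IsContinuousRDS T)
    (hf : f ∈ (L1C P : Set (Ω × X → ℝ))) (hg : g ∈ (L1C P : Set (Ω × X → ℝ)))
    {c : Ω → ℝ} (hc : Integrable c P) (h : ∀ ω x, f (ω, x) ≤ g (ω, x) + c ω) :
    upperMdim P θ T f ≤ upperMdim P θ T g + ((∫ ω, c ω ∂P : ℝ) : EReal) := by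
  have hci : ∀ j, Integrable (fun ω => c (θ^[j] ω)) P := fun j =>
    (hθ.iterate j).integrable_comp_of_integrable hc
  refine upperMdim_le_add_of_birkhoff_le hθ hT hf hg
    (c := fun n ω => ∑ j ∈ Finset.range n, c (θ^[j] ω))
    (fun n => integrable_finsetSum _ fun j _ => hci j) (birkhoff_le_add θ T h) ?_
  -- By invariance of P the averaged error equals ∫ c dP for every n ≠ 0.
  refine tendsto_const_nhds.congr' ?_
  filter_upwards [eventually_ne_atTop 0] with n hn
  rw [integral_finsetSum _ fun j _ => hci j]
  have : ∀ j, ∫ ω, c (θ^[j] ω) ∂P = ∫ ω, c ω ∂P := fun j => by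
    have hm := (hθ.iterate j).map_eq
    conv_rhs => rw [← hm]
    rw [integral_map (hθ.iterate j).aemeasurable (by rw [hm]; exact hc.aestronglyMeasurable)]
  simp only [this, Finset.sum_const, Finset.card_range, nsmul_eq_mul]
  field_simp

/-- The telescoped sum is at most h(θⁿω) + h(ω), whose integral 2 ∫ h dP is independent of n and
disappears after division by n. -/
lemma upperMdim_coboundary_le (hθ : MeasurePreserving θ P P) (hT : IsContinuousRDS T)
    (hg : g ∈ (L1C P : Set (Ω × X → ℝ))) :
    upperMdim P θ T (g ∘ skew θ T - g) ≤ upperMdim P θ T (fun _ => 0) := by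
  obtain ⟨-, -, h, hh, hgh⟩ := mem_L1C_iff.1 hg
  have hmem : g ∘ skew θ T - g ∈ (L1C P : Set (Ω × X → ℝ)) := by
    have := add_mem_L1C (comp_skew_mem_L1C hθ hT hg) (smul_mem_L1C (-1) hg)
    rwa [neg_one_smul, ← sub_eq_add_neg] at this
  have hi : ∀ n, Integrable (fun ω => h (θ^[n] ω)) P := fun n =>
    (hθ.iterate n).integrable_comp_of_integrable hh
  have := upperMdim_le_add_of_birkhoff_le (g := fun _ => 0) (C := 0) hθ hT hmem (const_mem_L1C 0)
    (c := fun n ω => h (θ^[n] ω) + h ω) (fun n => (hi n).add hh) (fun n ω x => ?_) ?_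
  · simpa using this
  · have h1 := (abs_le.1 (hgh (θ^[n] ω) (iter θ T n ω x))).2
    have h2 := (abs_le.1 (hgh ω x)).1
    rw [birkhoff_coboundary]
    simp only [birkhoff, Finset.sum_const_zero]
    linarith
  · have : ∀ n : ℕ, ∫ ω, (h (θ^[n] ω) + h ω) ∂P = 2 * ∫ ω, h ω ∂P := fun n => by
      have hm := (hθ.iterate n).map_eq
      rw [integral_add (hi n) hh, two_mul]
      congr 1
      conv_rhs => rw [← hm]
      rw [integral_map (hθ.iterate n).aemeasurable (by rw [hm]; exact hh.aestronglyMeasurable)]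
    simp only [this]
    simpa using tendsto_one_div_atTop_nhds_zero_nat.mul_const (2 * ∫ ω, h ω ∂P)

omit [Nonempty X] [BorelSpace X] [MeasurableSpace X] [IsFiniteMeasure P] in
lemma upperMdim_zero_nonneg [Nonempty X] : 0 ≤ upperMdim P θ T (fun _ => 0) := by
  by_contra! hneg
  obtain ⟨A, hA, hA0⟩ := EReal.lt_iff_exists_real_btwn.1 hneg
  obtain ⟨ε, hε, h0, h1⟩ := ((hasRate_of_upperMdim_lt hA).and eventually_mem_Ioo).exists
  obtain ⟨n, hn⟩ := hε.exists
  have hA0' : A < 0 := by exact_mod_cast hA0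
  have h1n : 0 ≤ (1 / (n : ℝ)) * ∫ ω, Real.log (sepSum θ T (fun _ => 0) n ω ε) ∂P := by
    refine mul_nonneg (by positivity) (integral_nonneg fun ω => Real.log_nonneg ?_)
    -- A single point has weight (1/ε)⁰ = 1, so the partition sum is at least 1.
    have := rpow_le_sepSum (θ := θ) (T := T) (f := fun _ => 0) (n := n) (ω := ω) (H := 0) h0 h1
      (fun x => by simp [birkhoff]) (Classical.arbitrary X)
    simpa [birkhoff] using this
  nlinarith [log_one_div_pos h0 h1]

/-- The upper mean dimension is finite on `L¹(Ω, C(X))` once it is finite at `0`. -/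
lemma coe_toReal_upperMdim (hθ : MeasurePreserving θ P P) (hT : IsContinuousRDS T)
    (hfin : upperMdim P θ T (fun _ => 0) < ⊤) (hf : f ∈ (L1C P : Set (Ω × X → ℝ))) :
    ((upperMdim P θ T f).toReal : EReal) = upperMdim P θ T f := by
  obtain ⟨-, -, h, hh, hfh⟩ := mem_L1C_iff.1 hf
  have h0 := const_mem_L1C (X := X) (P := P) 0
  have h1 := upperMdim_le_add hθ hT hf h0 hh fun ω x => by
    linarith [(abs_le.1 (hfh ω x)).2]
  have h2 := upperMdim_le_add hθ hT h0 hf hh fun ω x => by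
    linarith [(abs_le.1 (hfh ω x)).1]
  refine EReal.coe_toReal (fun htop => ?_) fun hbot => ?_
  · rw [htop, top_le_iff] at h1
    exact (EReal.add_lt_top hfin.ne (EReal.coe_ne_top _)).ne h1
  · rw [hbot, EReal.bot_add, le_bot_iff] at h2
    exact absurd upperMdim_zero_nonneg (by rw [h2]; simp)

lemma toReal_upperMdim_le_add (hθ : MeasurePreserving θ P P) (hT : IsContinuousRDS T)
    (hfin : upperMdim P θ T (fun _ => 0) < ⊤)
    (hf : f ∈ (L1C P : Set (Ω × X → ℝ))) (hg : g ∈ (L1C P : Set (Ω × X → ℝ)))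
    {c : Ω → ℝ} (hc : Integrable c P) (h : ∀ ω x, f (ω, x) ≤ g (ω, x) + c ω) :
    (upperMdim P θ T f).toReal ≤ (upperMdim P θ T g).toReal + ∫ ω, c ω ∂P := by
  have := upperMdim_le_add hθ hT hf hg hc h
  rw [← coe_toReal_upperMdim hθ hT hfin hf, ← coe_toReal_upperMdim hθ hT hfin hg] at this
  exact_mod_cast this

lemma toReal_upperMdim_convex (hθ : MeasurePreserving θ P P) (hT : IsContinuousRDS T)
    (hfin : upperMdim P θ T (fun _ => 0) < ⊤)
    (hf : f ∈ (L1C P : Set (Ω × X → ℝ))) (hg : g ∈ (L1C P : Set (Ω × X → ℝ)))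
    {s t : ℝ} (hs : 0 ≤ s) (ht : 0 ≤ t) (hst : s + t = 1) :
    (upperMdim P θ T (s • f + t • g)).toReal ≤
      s * (upperMdim P θ T f).toReal + t * (upperMdim P θ T g).toReal := by
  -- The slack δ is needed because a rate is only guaranteed strictly above the mean dimension.
  refine le_of_forall_pos_le_add fun δ hδ => ?_
  have hrate : ∀ {u : Ω × X → ℝ}, u ∈ (L1C P : Set (Ω × X → ℝ)) →
      HasRate P θ T u ((upperMdim P θ T u).toReal + δ) := fun {u} hu => by
    refine hasRate_of_upperMdim_lt ?_
    rw [← coe_toReal_upperMdim hθ hT hfin hu]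
    exact_mod_cast lt_add_of_pos_right _ hδ
  have := upperMdim_le_of_hasRate (HasRate.convex hθ hT hf hg hs ht hst (hrate hf) (hrate hg))
  rw [← coe_toReal_upperMdim hθ hT hfin
    (add_mem_L1C (smul_mem_L1C s hf) (smul_mem_L1C t hg))] at this
  have : (upperMdim P θ T (s • f + t • g)).toReal ≤
    s * ((upperMdim P θ T f).toReal + δ) + t * ((upperMdim P θ T g).toReal + δ) := by
      exact_mod_cast this
  calc _ ≤ _ := this
    _ = s * (upperMdim P θ T f).toReal + t * (upperMdim P θ T g).toReal + (s + t) * δ := by ring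
    _ = _ := by rw [hst, one_mul]

end RandomMdim

/-! ### Hahn–Banach for convex functions -/

namespace RandomMdim

/-- A real convex function vanishing at the origin dominates a linear functional. -/
lemma exists_linear_le_of_convex {E : Type*} [AddCommGroup E] [Module ℝ E] (Λ : E → ℝ)
    (h0 : Λ 0 = 0)
    (hconv : ∀ x y : E, ∀ s t : ℝ, 0 ≤ s → 0 ≤ t → s + t = 1 →
      Λ (s • x + t • y) ≤ s * Λ x + t * Λ y) :
    ∃ L : E →ₗ[ℝ] ℝ, ∀ x, L x ≤ Λ x := by
  -- The origin is the convex combination of t • x and -x with weights 1/(1+t) and t/(1+t), so the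
  -- slopes of Λ along x are bounded below.
  have hlow : ∀ x : E, ∀ t : ℝ, 0 < t → -Λ (-x) ≤ Λ (t • x) / t := fun x t ht => by
    have h := hconv (t • x) (-x) (1 / (1 + t)) (t / (1 + t)) (by positivity) (by positivity)
      (by field_simp)
    have he : (1 / (1 + t)) • t • x + (t / (1 + t)) • -x = 0 := by
      rw [smul_smul, smul_neg, one_div_mul_eq_div, add_neg_cancel]
    rw [he, h0] at h
    have h' : 0 ≤ Λ (t • x) + t * Λ (-x) := by
      have : 0 < 1 + t := by positivity
      calc 0 ≤ (1 + t) * (1 / (1 + t) * Λ (t • x) + t / (1 + t) * Λ (-x)) :=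
            mul_nonneg this.le h
        _ = _ := by field_simp
    rw [le_div_iff₀ ht]
    linarith
  -- The infimum of the slopes is the one-sided directional derivative of Λ at 0: sublinear and
  -- below Λ.
  let N : E → ℝ := fun x => ⨅ t : Set.Ioi (0 : ℝ), Λ ((t : ℝ) • x) / t
  have hbdd : ∀ x, BddBelow (Set.range fun t : Set.Ioi (0 : ℝ) => Λ ((t : ℝ) • x) / t) :=
    fun x => ⟨-Λ (-x), by rintro _ ⟨t, rfl⟩; exact hlow x t t.2⟩
  have hN : ∀ x (t : ℝ), 0 < t → N x ≤ Λ (t • x) / t := fun x t ht =>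
    ciInf_le (hbdd x) ⟨t, ht⟩
  have hNhom_le : ∀ c : ℝ, 0 < c → ∀ x, N (c • x) ≤ c * N x := fun c hc x => by
    rw [← div_le_iff₀' hc]
    refine le_ciInf fun t => ?_
    rw [div_le_iff₀' hc]
    have ht : (0 : ℝ) < t := t.2
    refine (hN (c • x) (t / c) (by positivity)).trans (le_of_eq ?_)
    rw [smul_smul, div_mul_cancel₀ _ hc.ne']
    field_simp
  have hNhom : ∀ c : ℝ, 0 < c → ∀ x, N (c • x) = c * N x := fun c hc x => by
    refine le_antisymm (hNhom_le c hc x) ?_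
    have := hNhom_le c⁻¹ (by positivity) (c • x)
    rwa [smul_smul, inv_mul_cancel₀ hc.ne', one_smul, inv_mul_eq_div, le_div_iff₀' hc] at this
  have hNadd : ∀ x y, N (x + y) ≤ N x + N y := fun x y => by
    refine le_ciInf_add_ciInf fun s t => ?_
    have hs : (0 : ℝ) < s := s.2
    have ht : (0 : ℝ) < t := t.2
    have hst : (0 : ℝ) < s + t := by positivity
    have h := hconv ((s : ℝ) • x) ((t : ℝ) • y) (t / (s + t)) (s / (s + t)) (by positivity)
      (by positivity) (by field_simp; ring)
    -- With τ = st/(s+t), τ(x + y) is a convex combination of s • x and t • y, and the weights turn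
    -- Λ(τ(x + y))/τ into at most the sum of the two slopes.
    refine (hN (x + y) (s * t / (s + t)) (by positivity)).trans ?_
    have he : ((s : ℝ) * t / (s + t)) • (x + y) =
        ((t : ℝ) / (s + t)) • (s : ℝ) • x + ((s : ℝ) / (s + t)) • (t : ℝ) • y := by
      rw [smul_smul, smul_smul, smul_add]
      congr 2 <;> ring
    rw [he, div_le_iff₀ (by positivity)]
    refine h.trans (le_of_eq ?_)
    field_simp
  -- The zero functional on the zero subspace is extended under the sublinear bound N.
  obtain ⟨L, -, hL⟩ := exists_extension_of_le_sublinear ⟨⊥, 0⟩ N hNhom hNadd (by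
    rintro ⟨x, hx⟩
    obtain rfl : x = 0 := (Submodule.mem_bot ℝ).1 hx
    refine le_ciInf fun t => ?_
    simp [h0])
  refine ⟨L, fun x => (hL x).trans ?_⟩
  simpa using hN x 1 one_pos

/-! ### Representation by measures with marginal P -/

section Riesz

variable {Ω X : Type*} [MetricSpace Ω] [LocallyCompactSpace Ω] [SecondCountableTopology Ω]
  [MeasurableSpace Ω] [BorelSpace Ω] [MetricSpace X] [CompactSpace X] [Nonempty X]
  [MeasurableSpace X] [BorelSpace X] {P : Measure Ω} [IsProbabilityMeasure P]

omit [LocallyCompactSpace Ω] [SecondCountableTopology Ω] in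
lemma compactlySupported_mem_L1C (φ : CompactlySupportedContinuousMap (Ω × X) ℝ) :
    ⇑φ ∈ (L1C P : Set (Ω × X → ℝ)) := by
  obtain ⟨C, hC⟩ := φ.hasCompactSupport.exists_bound_of_continuous φ.continuous
  exact bounded_mem_L1C φ.continuous.measurable
    (fun ω => φ.continuous.comp (Continuous.prodMk_right ω)) C hC

/-- A linear functional on `L¹(Ω, C(X))` dominated by `f ↦ ∫ sup f(ω, ·) dP` is integration
against a measure with marginal `P`. -/
lemma exists_measure_of_linear (L : L1CSubmodule X P →ₗ[ℝ] ℝ)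
    (hL : ∀ (f : L1CSubmodule X P) (c : Ω → ℝ), Integrable c P →
      (∀ ω x, (f : Ω × X → ℝ) (ω, x) ≤ c ω) → L f ≤ ∫ ω, c ω ∂P) :
    ∃ μ : Measure (Ω × X), IsProbabilityMeasure μ ∧ μ.map Prod.fst = P ∧
      ∀ f : L1CSubmodule X P, L f = ∫ p, (f : Ω × X → ℝ) p ∂μ := by
  let incl : CompactlySupportedContinuousMap (Ω × X) ℝ →ₗ[ℝ] L1CSubmodule X P :=
    { toFun := fun φ => ⟨φ, compactlySupported_mem_L1C φ⟩
      map_add' := fun _ _ => rfl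
      map_smul' := fun _ _ => rfl }
  let Λ : CompactlySupportedContinuousMap (Ω × X) ℝ →ₚ[ℝ] ℝ :=
    PositiveLinearMap.mk₀ (L ∘ₗ incl) fun φ hφ => by
      have := hL (-incl φ) (fun _ => 0) (integrable_zero _ _ _) fun ω x => by
        simpa [incl] using hφ (ω, x)
      rw [map_neg, integral_zero] at this
      simpa using this
  let μ := RealRMK.rieszMeasure Λ
  have hμ : ∀ φ : CompactlySupportedContinuousMap (Ω × X) ℝ, ∫ p, φ p ∂μ = L (incl φ) :=
    RealRMK.integral_rieszMeasure Λ
  have hmarg : μ.map Prod.fst = P := by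
    have : IsFiniteMeasureOnCompacts (μ.map Prod.fst) := ⟨fun K hK => by
      rw [Measure.map_apply measurable_fst hK.measurableSet, ← Set.prod_univ]
      exact (hK.prod isCompact_univ).measure_lt_top⟩
    have : IsLocallyFiniteMeasure (μ.map Prod.fst) :=
      isLocallyFiniteMeasure_of_isFiniteMeasureOnCompacts
    refine Measure.ext_of_integral_eq_on_compactlySupported fun u => ?_
    obtain ⟨C, hC⟩ := u.hasCompactSupport.exists_bound_of_continuous u.continuous
    have hu : Integrable u P := u.continuous.integrable_of_hasCompactSupport u.hasCompactSupport
    let φ : CompactlySupportedContinuousMap (Ω × X) ℝ :=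
      { toFun := fun p => u p.1
        continuous_toFun := u.continuous.comp continuous_fst
        hasCompactSupport' := HasCompactSupport.intro
          (u.hasCompactSupport.prod (isCompact_univ (X := X))) fun p hp => by
            refine image_eq_zero_of_notMem_tsupport fun h => hp ⟨h, Set.mem_univ _⟩ }
    rw [integral_map measurable_fst.aemeasurable (map_continuous u).aestronglyMeasurable]
    -- A function of ω alone and its negative are both their own dominating function, so the
    -- one-sided bound on L gives equality.
    refine (hμ φ).trans (le_antisymm (hL _ _ hu fun ω x => le_rfl) ?_)
    have := hL (-incl φ) (fun ω => -u ω) hu.neg fun ω x => le_rfl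
    rw [map_neg, integral_neg] at this
    linarith
  have hprob : IsProbabilityMeasure μ := ⟨by
    rw [← Set.preimage_univ (f := Prod.fst), ← Measure.map_apply measurable_fst MeasurableSet.univ,
      hmarg, measure_univ]⟩
  refine ⟨μ, hprob, hmarg, ?_⟩
  have hle : ∀ f : L1CSubmodule X P, L f ≤ ∫ p, (f : Ω × X → ℝ) p ∂μ := fun f => by
    refine le_of_forall_pos_le_add fun δ hδ => ?_
    -- Replacing f by the approximant costs at most δ/2 in L, by domination, and at most δ/2 in the
    -- integral, because μ has marginal P.
    obtain ⟨G, hGs, hGδ, hGc, hGi⟩ :=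
      (integrable_slice f.2).exists_hasCompactSupport_integral_sub_le (half_pos hδ)
    let φ : CompactlySupportedContinuousMap (Ω × X) ℝ :=
      { toFun := fun p => G p.1 p.2
        continuous_toFun := by fun_prop
        hasCompactSupport' := HasCompactSupport.intro
          (hGs.prod (isCompact_univ (X := X))) fun p hp => by
            rw [image_eq_zero_of_notMem_tsupport fun h => hp ⟨h, Set.mem_univ _⟩]
            rfl }
    let h : Ω → ℝ := fun ω => ‖slice f.1 f.2.2.1 ω - G ω‖
    have hh : Integrable h P := ((integrable_slice f.2).sub hGi).norm
    have hhμ : Integrable (fun p : Ω × X => h p.1) μ := by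
      rw [← hmarg] at hh
      exact hh.comp_measurable measurable_fst
    have hfφ : ∀ ω x, |f.1 (ω, x) - φ (ω, x)| ≤ h ω := fun ω x =>
      (slice f.1 f.2.2.1 ω - G ω).norm_coe_le_norm x
    have hL1 : L f - L (incl φ) ≤ ∫ ω, h ω ∂P := by
      rw [← map_sub]
      exact hL _ h hh fun ω x => (abs_le.1 (hfφ ω x)).2
    have hI : ∫ p, φ p ∂μ ≤ ∫ p, f.1 p ∂μ + ∫ ω, h ω ∂P := by
      have e : ∫ ω, h ω ∂P = ∫ p, h p.1 ∂μ := by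
        conv_lhs => rw [← hmarg]
        rw [integral_map measurable_fst.aemeasurable (by rw [hmarg]; exact hh.aestronglyMeasurable)]
      have hfi := integrable_of_mem_marginalMeasures hmarg f.2
      rw [e, ← integral_add hfi hhμ]
      refine integral_mono (integrable_of_mem_marginalMeasures hmarg
        (compactlySupported_mem_L1C φ)) (hfi.add hhμ) fun p => ?_
      have := (abs_le.1 (hfφ p.1 p.2)).1
      beta_reduce
      linarith
    rw [hμ] at hI
    have : ∫ ω, h ω ∂P ≤ δ / 2 := hGδ
    change L f ≤ ∫ p, f.1 p ∂μ + δ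
    linarith
  intro f
  refine le_antisymm (hle f) ?_
  have := hle (-f)
  simp only [map_neg, NegMemClass.coe_neg, Pi.neg_apply, integral_neg] at this
  linarith

end Riesz

/-! ### The invariant subgradient and the normalised infimum -/

section Main

variable {Ω X : Type*} [MetricSpace Ω] [LocallyCompactSpace Ω] [SecondCountableTopology Ω]
  [MeasurableSpace Ω] [BorelSpace Ω] [MetricSpace X] [CompactSpace X] [Nonempty X]
  [MeasurableSpace X] [BorelSpace X] {P : Measure Ω} [IsProbabilityMeasure P]
  {θ : Ω → Ω} {T : Ω → X → X}

/-- There is an invariant measure that is a subgradient at `0` of the upper mean dimension. -/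
lemma exists_invariant_subgradient (hθ : MeasurePreserving θ P P) (hT : IsContinuousRDS T)
    (hfin : upperMdim P θ T (fun _ => 0) < ⊤) :
    ∃ μ ∈ invariantMeasures P θ T, ∀ f ∈ (L1C P : Set (Ω × X → ℝ)),
      ∫ p, f p ∂μ ≤ (upperMdim P θ T f).toReal - (upperMdim P θ T (fun _ => 0)).toReal := by
  have h0 := const_mem_L1C (X := X) (P := P) 0
  obtain ⟨L, hL⟩ := exists_linear_le_of_convex
    (fun f : L1CSubmodule X P => (upperMdim P θ T (f : Ω × X → ℝ)).toReal -
      (upperMdim P θ T (fun _ => 0)).toReal) (sub_self _) fun f g s t hs ht hst => by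
      have := toReal_upperMdim_convex hθ hT hfin f.2 g.2 hs ht hst
      have e : (upperMdim P θ T (fun _ => 0)).toReal = (s + t) *
        (upperMdim P θ T (fun _ => 0)).toReal := by rw [hst, one_mul]
      simp only [Submodule.coe_add, Submodule.coe_smul]
      linarith
  obtain ⟨μ, hμp, hμm, hμL⟩ := exists_measure_of_linear L fun f c hc hfc => by
    have := toReal_upperMdim_le_add hθ hT hfin f.2 h0 hc fun ω x => by
      rw [zero_add]; exact hfc ω x
    linarith [hL f]
  have hskew : Measurable (skew θ T) :=
    (hθ.measurable.comp measurable_fst).prodMk hT.measurable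
  have hco : ∀ g : Ω × X → ℝ, g ∈ (L1C P : Set (Ω × X → ℝ)) →
      ∫ p, g (skew θ T p) ∂μ ≤ ∫ p, g p ∂μ := fun g hg => by
    have hgs := comp_skew_mem_L1C hθ hT hg
    let a : L1CSubmodule X P := ⟨g, hg⟩
    let b : L1CSubmodule X P := ⟨g ∘ skew θ T, hgs⟩
    have h1 := hL (b - a)
    have h2 : (upperMdim P θ T (b - a : L1CSubmodule X P)).toReal ≤
        (upperMdim P θ T (fun _ => 0)).toReal := by
      have : upperMdim P θ T (b - a : L1CSubmodule X P) ≤ upperMdim P θ T (fun _ => 0) :=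
        upperMdim_coboundary_le hθ hT hg
      rw [← coe_toReal_upperMdim hθ hT hfin h0,
        ← coe_toReal_upperMdim hθ hT hfin (b - a).2] at this
      exact_mod_cast this
    rw [map_sub, hμL, hμL] at h1
    change ∫ p, (b : Ω × X → ℝ) p ∂μ ≤ ∫ p, (a : Ω × X → ℝ) p ∂μ
    linarith
  refine ⟨μ, ⟨⟨hμp, hμm⟩, hskew, ?_⟩, fun f hf => (hμL ⟨f, hf⟩).symm.le.trans (hL ⟨f, hf⟩)⟩
  have : IsProbabilityMeasure (μ.map (skew θ T)) :=
    Measure.isProbabilityMeasure_map hskew.aemeasurable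
  -- Finite Borel measures on Ω × X are determined by bounded continuous functions, all of which lie
  -- in L¹(Ω, C(X)).
  refine ext_of_forall_integral_eq_of_IsFiniteMeasure fun φ => ?_
  rw [integral_map hskew.aemeasurable φ.continuous.aestronglyMeasurable]
  have hmem : ∀ ψ : BoundedContinuousFunction (Ω × X) ℝ, ⇑ψ ∈ (L1C P : Set (Ω × X → ℝ)) :=
    fun ψ => bounded_mem_L1C ψ.continuous.measurable
      (fun ω => ψ.continuous.comp (Continuous.prodMk_right ω)) ‖ψ‖ ψ.norm_coe_le_norm
  refine le_antisymm (hco φ (hmem φ)) ?_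
  have := hco (-φ) (hmem (-φ))
  simp only [Pi.neg_apply, integral_neg] at this
  linarith

omit [LocallyCompactSpace Ω] [SecondCountableTopology Ω] [MetricSpace Ω] [BorelSpace Ω] in
-- For f ∈ 𝒜 the potential -f is a competitor with value ∫ f dμ. Conversely, with G = mdim(f), the
-- function G - f lies in 𝒜 and its integral is exactly the value of the competitor f.
lemma measureMdim_eq_iInf_zeroSet (hθ : MeasurePreserving θ P P) (hT : IsContinuousRDS T)
    (hfin : upperMdim P θ T (fun _ => 0) < ⊤) {μ : Measure (Ω × X)}
    (hμ : μ ∈ (marginalMeasures P : Set (Measure (Ω × X)))) :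
    measureMdim P θ T μ = ⨅ f ∈ zeroSet P θ T, ((∫ p, f p ∂μ : ℝ) : EReal) := by
  have := hμ.1
  refine le_antisymm (le_iInf₂ fun f hf => ?_) (le_iInf₂ fun f hf => ?_)
  · have hneg : (fun p => -f p) ∈ (L1C P : Set (Ω × X → ℝ)) := by
      have := smul_mem_L1C (-1) hf.1
      rwa [neg_one_smul] at this
    refine (iInf₂_le _ hneg).trans (le_of_eq ?_)
    rw [hf.2, integral_neg, zero_sub, EReal.coe_neg, neg_neg]
  · have hG := coe_toReal_upperMdim hθ hT hfin hf
    set G := (upperMdim P θ T f).toReal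
    have hsub : ∀ a : ℝ, (fun p => f p + a) ∈ (L1C P : Set (Ω × X → ℝ)) := fun a =>
      add_mem_L1C hf (const_mem_L1C a)
    have hmem : (fun p => G - f p) ∈ (L1C P : Set (Ω × X → ℝ)) := by
      have := smul_mem_L1C (-1) (hsub (-G))
      rw [neg_one_smul] at this
      convert this using 2 with p
      simp only [Pi.neg_apply]
      ring
    have hz : (fun p => G - f p) ∈ zeroSet P θ T := by
      refine ⟨hmem, ?_⟩
      have e : (fun p => -(G - f p)) = fun p => f p + -G := by funext p; ring
      rw [e, ← coe_toReal_upperMdim hθ hT hfin (hsub (-G))]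
      -- Comparing f - G with f in both directions shows that subtracting G lowers the mean
      -- dimension by exactly G.
      have h1 := toReal_upperMdim_le_add hθ hT hfin (hsub (-G)) hf (integrable_const (-G))
        fun ω x => le_rfl
      have h2 := toReal_upperMdim_le_add hθ hT hfin hf (hsub (-G)) (integrable_const G)
        fun ω x => by linarith
      simp only [integral_const, probReal_univ, one_smul] at h1 h2
      have : (upperMdim P θ T fun p => f p + -G).toReal = 0 := by
        change _ ≤ G + -G at h1
        change G ≤ _ at h2
        linarith
      rw [this, EReal.coe_zero]
    refine (iInf₂_le _ hz).trans (le_of_eq ?_)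
    rw [← hG, integral_sub (integrable_const _) (integrable_of_mem_marginalMeasures hμ.2 hf)]
    simp

end Main

end RandomMdim

theorem theorem1p1 {Ω X : Type*}
    [MetricSpace Ω] [LocallyCompactSpace Ω] [TopologicalSpace.SeparableSpace Ω]
    [MeasurableSpace Ω] [BorelSpace Ω]
    [MetricSpace X] [CompactSpace X] [Nonempty X] [MeasurableSpace X] [BorelSpace X]
    (P : Measure Ω) [IsProbabilityMeasure P] (θ : Ω → Ω) (hθ : Ergodic θ P)
    (T : Ω → X → X) (hT : RandomMdim.IsContinuousRDS T)
    (hfin : RandomMdim.upperMdim P θ T (fun _ => 0) < ⊤) :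
    (∀ μ ∈ (RandomMdim.marginalMeasures P : Set (Measure (Ω × X))),
      RandomMdim.measureMdim P θ T μ =
        ⨅ f ∈ RandomMdim.zeroSet P θ T, ((∫ p, f p ∂μ : ℝ) : EReal)) ∧
    RandomMdim.upperMdim P θ T (fun _ => 0) =
      ⨆ μ ∈ RandomMdim.invariantMeasures P θ T, RandomMdim.measureMdim P θ T μ ∧
    ∃ μ ∈ RandomMdim.invariantMeasures P θ T,
      RandomMdim.measureMdim P θ T μ = RandomMdim.upperMdim P θ T (fun _ => 0) := by
  open RandomMdim in
  have := UniformSpace.secondCountable_of_separable Ω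
  have hmp := hθ.toMeasurePreserving
  have h0 := const_mem_L1C (X := X) (P := P) 0
  have hle : ∀ μ : Measure (Ω × X), measureMdim P θ T μ ≤ upperMdim P θ T (fun _ => 0) :=
    fun μ => (iInf₂_le _ h0).trans (by simp)
  obtain ⟨μ, hμ, hsub⟩ := exists_invariant_subgradient hmp hT hfin
  have hattain : measureMdim P θ T μ = upperMdim P θ T (fun _ => 0) := by
    refine le_antisymm (hle μ) (le_iInf₂ fun f hf => ?_)
    rw [← coe_toReal_upperMdim hmp hT hfin h0, ← coe_toReal_upperMdim hmp hT hfin hf,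
      ← EReal.coe_sub]
    -- The subgradient inequality at 0, rearranged, bounds every competitor below by mdim(0).
    exact_mod_cast le_sub_comm.1 (hsub f hf)
  refine ⟨fun ν hν => measureMdim_eq_iInf_zeroSet hmp hT hfin hν, le_antisymm ?_ ?_,
    μ, hμ, hattain⟩
  · rw [← hattain]
    exact le_iSup₂ (f := fun ν _ => measureMdim P θ T ν) μ hμ
  · exact iSup₂_le fun ν _ => hle ν
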